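/- An abstract simplicial complex here is a finite family $K$ of finite sets closed under taking subsets; $\emptyset$ counts as a simplex, so the void complex (no simplices) differs from the empty complex $\{\emptyset\}$. A simplex $\tau\in K$ is free if it is a proper face of a maximal simplex of $K$ and lies in no other maximal simplex; a collapse removes from $K$ all simplices containing a free simplex $\tau$. Write $K\searrow L$ if a finite sequence of collapses leads from $K$ to $L$, and call $K$ collapsible if it collapses to the void complex. For a finite set $S$ (of processes), a read/write execution on $S$ is a linear order $\to$ on the set of operations $\{w_i, r_i(j): i,j\in S\}$ with $w_i\to r_i(j)$ for all $i,j\in S$; the view of $i$ is $view_i=\{j\in S: w_j\to r_i(j)\}$. The complex $\mathsf{WR}(S)$ consists of all subsets of the sets $\{(i,view_i): i\in S\}$ arising from read/write executions on $S$. The chromatic subdivision $\chi(S)$ consists of all finite sets of pairs $(v,T)$ with $v\in T\subseteq S$ such that for any two elements $(v,T),(v',T')$ of the set one has $T\subseteq T'$ or $T'\subseteq T$, and $v\in T'$ implies $T\subseteq T'$. For a complex $K$ put $\mathsf{WR}(K)=\bigcup_{\sigma\in K}\mathsf{WR}(\sigma)$ and $\chi(K)=\bigcup_{\sigma\in K}\chi(\sigma)$.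 Let $\Delta^n$ be the complex of all subsets of $\{0,\dots,n\}$, and let $\mathsf{WR}^{(0)}(\Delta^n)=\chi^{(0)}(\Delta^n)=\Delta^n$, $\mathsf{WR}^{(k+1)}(\Delta^n)=\mathsf{WR}(\mathsf{WR}^{(k)}(\Delta^n))$, $\chi^{(k+1)}(\Delta^n)=\chi(\chi^{(k)}(\Delta^n))$. Theorem. For all $n\ge 0$ and $k\ge 1$, $\mathsf{WR}^{(k)}(\Delta^n)\searrow\chi^{(k)}(\Delta^n)$. Moreover $\chi^{(k)}(\Delta^n)$ is collapsible, $\mathsf{WR}^{(k)}(\Delta^n)$ is collapsible, and the geometric realization of $\mathsf{WR}^{(k)}(\Delta^n)$ is contractible. -/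

import Mathlib

namespace ReadWrite

/-! ### Simplicial complexes and collapses -/

/-- A (finite) abstract simplicial complex with vertices in `V`: a collection of finite sets closed
under passing to subsets. The empty set counts as a simplex, so that the void complex `⊥` (no
simplices at all) differs from the empty complex (whose only simplex is `∅`). The vertices of `K`
are those `v` with `{v} ∈ K`. -/
abbrev Cpx (V : Type) := LowerSet (Finset V)

/-- `σ` is a maximal simplex of `K`. -/
def IsFacet {V : Type} (K : Cpx V) (σ : Finset V) : Prop :=
  Maximal (fun ρ => ρ ∈ K) σ

/-- `τ` is a free simplex of `K`: it is a proper face of a maximal simplex `σ`, and no other maximal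
simplex contains it. -/
def IsFree {V : Type} (K : Cpx V) (τ : Finset V) : Prop :=
  ∃ σ, IsFacet K σ ∧ τ ⊂ σ ∧ ∀ ρ, IsFacet K ρ → τ ⊆ ρ → ρ = σ

/-- `L` is obtained from `K` by one collapse: all simplices containing some free simplex `τ` are
removed. -/
def CollapseStep {V : Type} (K L : Cpx V) : Prop :=
  ∃ τ, IsFree K τ ∧ ∀ ρ, ρ ∈ L ↔ ρ ∈ K ∧ ¬ τ ⊆ ρ

/-- `K ↘ L`: a finite sequence of collapses leads from `K` to `L`. -/
def CollapsesTo {V : Type} (K L : Cpx V) : Prop :=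
  Relation.ReflTransGen CollapseStep K L

/-- `K` is collapsible: it collapses to the void complex. (The last collapse of such a sequence
removes the free simplex `∅`, hence all of a full simplex with at least one vertex.) -/
def Collapsible {V : Type} (K : Cpx V) : Prop :=
  CollapsesTo K ⊥

/-- The geometric realization of a complex on a finite vertex type: barycentric coordinates whose
support is a simplex, with the topology inherited from `V → ℝ`. -/
def realization {V : Type} [Fintype V] (K : Cpx V) : Set (V → ℝ) :=
  {x | x ∈ stdSimplex ℝ V ∧ ∃ σ ∈ K, ∀ v, v ∈ σ ↔ x v ≠ 0}

/-! ### Executions of the one-round read/write model -/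

/-- The operations of the processes in `P`: `write i` is the write of process `i` to its own
register, `read i j` is the read by process `i` of the register of process `j`. -/
inductive Op (P : Type) : Type
  | write (i : P) : Op P
  | read (i j : P) : Op P

/-- A one-round read/write execution with participating set `P`: a linear order on all operations
in which every process writes before it reads. The reads of a process come in an arbitrary order. -/
structure Execution (P : Type) where
  prec : Op P → Op P → Prop
  isStrictTotalOrder : IsStrictTotalOrder (Op P) prec
  write_prec_read : ∀ i j : P, prec (Op.write i) (Op.read i j)

open Classical in
/-- The local view of process `i` in an execution with participating set `S`: the processes whose
write precedes the read of their register by `i`. -/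
noncomputable def Execution.view {V : Type} {S : Finset V} (α : Execution {v // v ∈ S})
    (i : {v // v ∈ S}) : Finset V :=
  (S.attach.filter fun j => α.prec (Op.write j) (Op.read i j)).map (Function.Embedding.subtype _)

/-- The view of an execution: all pairs consisting of a process and its local view. -/
def Execution.views {V : Type} {S : Finset V} (α : Execution {v // v ∈ S}) :
    Set (V × Finset V) :=
  Set.range fun i : {v // v ∈ S} => ((i : V), α.view i)

/-! ### The read/write complex and the chromatic subdivision -/

/-- `WR(S)`, the one-round read/write protocol complex of the simplex `S`: a set of pairs
(process, local view) is a simplex if it is contained in the view of some execution on `S`. -/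
def wrSimplex {V : Type} (S : Finset V) : Cpx (V × Finset V) where
  carrier := {ρ | ∃ α : Execution {v // v ∈ S}, (ρ : Set (V × Finset V)) ⊆ α.views}
  lower' := fun _ _ hle ⟨α, hα⟩ => ⟨α, (Finset.coe_subset.mpr hle).trans hα⟩

/-- `χ(S)`, the standard chromatic subdivision of the simplex `S` (the immediate snapshot complex):
its vertices are the pairs `(v, T)` with `v ∈ T ⊆ S`, and a set of vertices is a simplex if the
second components form a chain under inclusion (containment) and `v ∈ T'` implies `T ⊆ T'` for all
its elements `(v, T)`, `(v', T')` (immediacy). -/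
def chiSimplex {V : Type} (S : Finset V) : Cpx (V × Finset V) where
  carrier := {ρ | (∀ p ∈ ρ, p.1 ∈ p.2 ∧ p.2 ⊆ S) ∧
    ∀ p ∈ ρ, ∀ q ∈ ρ, (p.2 ⊆ q.2 ∨ q.2 ⊆ p.2) ∧ (p.1 ∈ q.2 → p.2 ⊆ q.2)}
  lower' := fun _ _ hle ⟨h₁, h₂⟩ =>
    ⟨fun p hp => h₁ p (hle hp), fun p hp q hq => h₂ p (hle hp) q (hle hq)⟩

/-- `WR(K)`, the union of the complexes `WR(σ)` over the simplices `σ` of `K`. -/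
def wr {V : Type} (K : Cpx V) : Cpx (V × Finset V) :=
  ⨆ σ ∈ K, wrSimplex σ

/-- `χ(K)`, the union of the complexes `χ(σ)` over the simplices `σ` of `K`. -/
def chi {V : Type} (K : Cpx V) : Cpx (V × Finset V) :=
  ⨆ σ ∈ K, chiSimplex σ

/-! ### Iteration -/

/-- The type of (potential) vertices after `k` rounds with `n + 1` processes: a process in the next
round is identified by its present vertex, and its view is a set of such vertices. -/
def Vert (n : ℕ) : ℕ → Type
  | 0 => Fin (n + 1)
  | k + 1 => Vert n k × Finset (Vert n k)

instance instFintypeVert (n : ℕ) : ∀ k, Fintype (Vert n k)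
  | 0 => inferInstanceAs (Fintype (Fin (n + 1)))
  | k + 1 =>
    letI := instFintypeVert n k
    inferInstanceAs (Fintype (Vert n k × Finset (Vert n k)))

/-- The `k`-round iterated read/write protocol complex `WR^(k)(Δ^n)`, with `WR^(0)(Δ^n) = Δ^n`. -/
def wrIter (n : ℕ) : (k : ℕ) → Cpx (Vert n k)
  | 0 => (⊤ : Cpx (Fin (n + 1)))
  | k + 1 => wr (wrIter n k)

/-- The `k`-th iterated chromatic subdivision `χ^(k)(Δ^n)`, with `χ^(0)(Δ^n) = Δ^n`. -/
def chiIter (n : ℕ) : (k : ℕ) → Cpx (Vert n k)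
  | 0 => (⊤ : Cpx (Fin (n + 1)))
  | k + 1 => chi (chiIter n k)

end ReadWrite

namespace ReadWrite
open scoped Classical

/-! Both complexes have combinatorial descriptions (`mem_wr`, `mem_chi`). A set ρ of views lies in
WR(K) iff it is acyclic and the processes it sees form a simplex of K; it lies in χ(K) iff moreover
it is immediate. Given acyclicity, containment follows from immediacy.

Collapses are produced by discrete Morse theory. By `collapsesTo_of_matching` it suffices to pair
off the simplices of K outside L by toggling a vertex, with a rank that is monotone under inclusion
and whose fibres share the toggled vertex along inclusions. One recursive matching serves twice. Let
N be the set of processes seen in ρ, enlarged by a fixed set Z, and let the lower part consist of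
the pairs whose view is not N. If the lower part together with Z already accounts for N, toggle a
pair (c, N). Otherwise toggle (y, N) with y ∈ N not seen below, unless this is the only pair with
view N; in that case recurse into the lower part.

With Z = ∅ on the acyclic non-immediate sets this gives WR(K) ↘ χ(K). With Z = {v} on snapshots it
shows that a collapse of K at τ, with v in the facet over τ but not in τ, induces χ(K) ↘ χ(L). Hence
WR(WR^(k)) ↘ χ(WR^(k)) ↘ χ(χ^(k)) by induction, and collapsing Δ^n to the void complex is carried
through every χ. Contractibility follows by realizing each collapse at a nonempty simplex as a
deformation retraction; a collapse at ∅ starts from a full simplex, whose realization is convex. -/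

/-! ### Collapses from acyclic matchings -/

/-- The complex obtained from `K` by deleting all simplices that contain `τ`. -/
def deletion {V : Type} (K : Cpx V) (τ : Finset V) : Cpx V where
  carrier := {ρ | ρ ∈ K ∧ ¬ τ ⊆ ρ}
  lower' := fun _ _ hle h => ⟨K.lower hle h.1, fun hτ => h.2 (hτ.trans hle)⟩

theorem mem_deletion {V : Type} {K : Cpx V} {τ ρ : Finset V} :
    ρ ∈ deletion K τ ↔ ρ ∈ K ∧ ¬ τ ⊆ ρ := Iff.rfl

theorem exists_facet {V : Type} [Finite V] {K : Cpx V} {ρ : Finset V} (h : ρ ∈ K) :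
    ∃ σ, IsFacet K σ ∧ ρ ⊆ σ := by
  obtain ⟨σ, hσ, hm⟩ := Set.Finite.exists_le_maximal (Set.toFinite {ρ | ρ ∈ K}) h
  exact ⟨σ, hm, hσ⟩

/-- A matching `ρ ↔ ρ ∆ {w ρ}` of the simplices of `K` outside `L`, acyclic because of the
monotone function `g`, gives rise to a collapse. -/
theorem collapsesTo_of_matching {V P : Type} [DecidableEq V] [Finite V] [PartialOrder P] {L : Cpx V}
    (g : Finset V → P) (w : Finset V → V) (K : Cpx V) (hLK : L ≤ K)
    (hg : ∀ ρ ρ', ρ ∉ L → ρ' ∈ K → ρ ⊆ ρ' → g ρ ≤ g ρ' ∧ (g ρ = g ρ' → w ρ = w ρ'))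
    (hins : ∀ ρ ∈ K, ρ ∉ L → insert (w ρ) ρ ∈ K ∧ g (insert (w ρ) ρ) = g ρ)
    (her : ∀ ρ ∈ K, ρ ∉ L → ρ.erase (w ρ) ∉ L ∧ g (ρ.erase (w ρ)) = g ρ) :
    CollapsesTo K L := by
  induction hn : {ρ | ρ ∈ K ∧ ρ ∉ L}.ncard using Nat.strong_induction_on generalizing K with
  | _ n ih =>
  by_cases hne : {ρ | ρ ∈ K ∧ ρ ∉ L}.Nonempty
  swap
  · have : K = L := by
      refine le_antisymm (fun ρ hρ => ?_) hLK
      by_contra h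
      exact hne ⟨ρ, hρ, h⟩
    rw [this]
    exact Relation.ReflTransGen.refl
  -- Maximize the rank first, then inclusion within that rank. Everything in `K` above a simplex of
  -- top rank outside `L` again has top rank, so the chosen `ρ` is a facet.
  obtain ⟨ρ₀, ⟨hρ₀K, hρ₀L⟩, hmax₀⟩ := Set.Finite.exists_maximalFor g _ (Set.toFinite _) hne
  obtain ⟨ρ, hρ₀, ⟨hρK, hρL, hρg⟩, hmax⟩ := Set.Finite.exists_le_maximal
    (Set.toFinite {ρ | ρ ∈ K ∧ ρ ∉ L ∧ g ρ = g ρ₀}) ⟨hρ₀K, hρ₀L, rfl⟩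
  have htop : ∀ τ ρ', τ ∉ L → g τ = g ρ₀ → ρ' ∈ K → τ ⊆ ρ' → ρ' ∉ L ∧ g ρ' = g ρ₀ := by
    intro τ ρ' hτ hgτ hρ' hsub
    have hL : ρ' ∉ L := fun h => hτ (L.lower hsub h)
    have hle := (hg τ ρ' hτ hρ' hsub).1
    rw [hgτ] at hle
    exact ⟨hL, le_antisymm (hmax₀ ⟨hρ', hL⟩ hle) hle⟩
  have hwρ : w ρ ∈ ρ := by
    have h1 := hins ρ hρK hρL
    have h2 := htop ρ _ hρL hρg h1.1 (Finset.subset_insert _ _)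
    exact hmax ⟨h1.1, h2.1, h2.2⟩ (Finset.subset_insert _ _) (Finset.mem_insert_self _ _)
  set τ := ρ.erase (w ρ) with hτdef
  obtain ⟨hτL, hτg⟩ := her ρ hρK hρL
  have hτρ : τ ⊆ ρ := Finset.erase_subset _ _
  have hτK : τ ∈ K := K.lower hτρ hρK
  have hwτ : w τ = w ρ := (hg τ ρ hτL hρK hτρ).2 hτg
  have hfacet : IsFacet K ρ := by
    refine ⟨hρK, fun ρ' hρ' hle => ?_⟩
    exact hmax ⟨hρ', htop ρ ρ' hρL hρg hρ' hle⟩ hle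
  -- A simplex over `τ` has the same rank, hence the same toggled vertex; adding that vertex gives a
  -- simplex of `K` containing the facet `ρ`. So only `τ` and `ρ` lie over `τ`.
  have hover : ∀ ρ' ∈ K, τ ⊆ ρ' → ρ' = τ ∨ ρ' = ρ := by
    intro ρ' hρ' hsub
    obtain ⟨hL, hg'⟩ := htop τ ρ' hτL (hτg.trans hρg) hρ' hsub
    have hw' : w ρ' = w ρ := by
      rw [← hwτ]
      exact ((hg τ ρ' hτL hρ' hsub).2 (by rw [hg', hτg, hρg])).symm
    have h1 := (hins ρ' hρ' hL).1
    rw [hw'] at h1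
    have h2 : ρ ⊆ insert (w ρ) ρ' := by
      intro x hx
      by_cases hxw : x = w ρ
      · simp [hxw]
      · exact Finset.mem_insert_of_mem (hsub (Finset.mem_erase.2 ⟨hxw, hx⟩))
    have h3 : insert (w ρ) ρ' = ρ := le_antisymm (hfacet.2 h1 h2) h2
    by_cases hmem : w ρ ∈ ρ'
    · right
      rwa [Finset.insert_eq_of_mem hmem] at h3
    · left
      calc ρ' = (insert (w ρ) ρ').erase (w ρ) := (Finset.erase_insert hmem).symm
        _ = τ := by rw [h3]
  have hssub : τ ⊂ ρ := Finset.erase_ssubset hwρ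
  have hstep : CollapseStep K (deletion K τ) := by
    refine ⟨τ, ⟨ρ, hfacet, hssub, fun ρ' hρ' hsub => ?_⟩, fun _ => mem_deletion⟩
    rcases hover ρ' hρ'.1 hsub with h | h
    · subst h
      exact absurd (hρ'.2 hρK hτρ) hssub.2
    · exact h
  refine Relation.ReflTransGen.head hstep (ih _ ?_ _ ?_ ?_ ?_ ?_ rfl)
  · rw [← hn]
    refine Set.ncard_lt_ncard ⟨fun x hx => ⟨hx.1.1, hx.2⟩, fun h => ?_⟩ (Set.toFinite _)
    exact (h (show τ ∈ {ρ | ρ ∈ K ∧ ρ ∉ L} from ⟨hτK, hτL⟩)).1.2 subset_rfl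
  · exact fun x hx => ⟨hLK hx, fun h => hτL (L.lower h hx)⟩
  · exact fun ρ₁ ρ₂ h1 h2 h3 => hg ρ₁ ρ₂ h1 h2.1 h3
  · rintro x ⟨hxK, hxτ⟩ hxL
    obtain ⟨h1, h2⟩ := hins x hxK hxL
    -- The matching restricts to the deletion: a partner containing `τ` would be `τ` or `ρ`, and
    -- these two are matched with each other.
    refine ⟨⟨h1, fun hsub => ?_⟩, h2⟩
    have hwx := (hg x _ hxL h1 (Finset.subset_insert _ _)).2 h2.symm
    have hx : x = insert (w x) x ∨ x = (insert (w x) x).erase (w x) := by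
      by_cases hm : w x ∈ x
      · left; rw [Finset.insert_eq_of_mem hm]
      · right; rw [Finset.erase_insert hm]
    rcases hx with hx | hx
    · exact hxτ (hx ▸ hsub)
    rcases hover _ h1 hsub with h | h
    · have : w τ ∈ τ := by
        rw [← h, ← hwx]; exact Finset.mem_insert_self _ _
      rw [hwτ] at this
      exact Finset.notMem_erase _ _ this
    · rw [h] at hwx
      rw [h, hwx] at hx
      exact hxτ (by rw [hx])
  · rintro x ⟨hxK, hxτ⟩ hxL
    exact her x hxK hxL

/-! ### A recursive matching on sets of views -/

section ViewMatching

variable {V : Type}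

/-- All processes seen in `ρ`, together with the processes in `Z`. -/
noncomputable def seen (Z : Finset V) (ρ : Finset (V × Finset V)) : Finset V :=
  Z ∪ ρ.biUnion Prod.snd

/-- The elements of `ρ` whose view is not the full set `seen Z ρ`. -/
noncomputable def lower (Z : Finset V) (ρ : Finset (V × Finset V)) : Finset (V × Finset V) :=
  ρ.filter fun p => p.2 ≠ seen Z ρ

/-- The elements of `ρ` whose view is the full set `seen Z ρ`. -/
noncomputable def top (Z : Finset V) (ρ : Finset (V × Finset V)) : Finset (V × Finset V) :=
  ρ.filter fun p => p.2 = seen Z ρ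

/-- The vertex with full view of a process of `ρ` that is not seen in the lower part. -/
noncomputable def fresh (pick : Finset V → V) (Z : Finset V) (ρ : Finset (V × Finset V)) :
    V × Finset V :=
  (pick (seen Z ρ \ seen Z (lower Z ρ)), seen Z ρ)

theorem mem_seen {Z : Finset V} {ρ : Finset (V × Finset V)} {x : V} :
    x ∈ seen Z ρ ↔ x ∈ Z ∨ ∃ p ∈ ρ, x ∈ p.2 := by
  simp [seen]

theorem snd_subset_seen {Z : Finset V} {ρ : Finset (V × Finset V)} {p : V × Finset V}
    (hp : p ∈ ρ) : p.2 ⊆ seen Z ρ :=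
  fun _ hx => mem_seen.2 (Or.inr ⟨p, hp, hx⟩)

theorem seen_mono {Z : Finset V} {ρ ρ' : Finset (V × Finset V)} (h : ρ ⊆ ρ') :
    seen Z ρ ⊆ seen Z ρ' := by
  intro x hx
  rcases mem_seen.1 hx with hx | ⟨p, hp, hx⟩
  · exact mem_seen.2 (Or.inl hx)
  · exact mem_seen.2 (Or.inr ⟨p, h hp, hx⟩)

theorem seen_insert {Z : Finset V} {ρ : Finset (V × Finset V)} {p : V × Finset V} :
    seen Z (insert p ρ) = seen Z ρ ∪ p.2 := by
  ext x
  simp only [Finset.mem_union, mem_seen, Finset.mem_insert]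
  constructor
  · rintro (h | ⟨q, rfl | hq, h⟩)
    exacts [Or.inl (Or.inl h), Or.inr h, Or.inl (Or.inr ⟨q, hq, h⟩)]
  · rintro ((h | ⟨q, hq, h⟩) | h)
    exacts [Or.inl h, Or.inr ⟨q, Or.inr hq, h⟩, Or.inr ⟨p, Or.inl rfl, h⟩]

theorem mem_lower {Z : Finset V} {ρ : Finset (V × Finset V)} {p : V × Finset V} :
    p ∈ lower Z ρ ↔ p ∈ ρ ∧ p.2 ≠ seen Z ρ := by
  simp [lower]

theorem mem_top {Z : Finset V} {ρ : Finset (V × Finset V)} {p : V × Finset V} :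
    p ∈ top Z ρ ↔ p ∈ ρ ∧ p.2 = seen Z ρ := by
  simp [top]

theorem lower_subset (Z : Finset V) (ρ : Finset (V × Finset V)) : lower Z ρ ⊆ ρ :=
  Finset.filter_subset _ _

theorem seen_lower_subset (Z : Finset V) (ρ : Finset (V × Finset V)) :
    seen Z (lower Z ρ) ⊆ seen Z ρ :=
  seen_mono (lower_subset Z ρ)

theorem mem_lower_or_mem_top {Z : Finset V} {ρ : Finset (V × Finset V)} {p : V × Finset V}
    (hp : p ∈ ρ) : p ∈ lower Z ρ ∨ p ∈ top Z ρ := by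
  rw [mem_lower, mem_top]
  tauto

theorem lower_mono {Z : Finset V} {ρ ρ' : Finset (V × Finset V)} (h : ρ ⊆ ρ')
    (hs : seen Z ρ = seen Z ρ') : lower Z ρ ⊆ lower Z ρ' := by
  intro p hp
  rw [mem_lower] at hp ⊢
  exact ⟨h hp.1, hs ▸ hp.2⟩

theorem top_mono {Z : Finset V} {ρ ρ' : Finset (V × Finset V)} (h : ρ ⊆ ρ')
    (hs : seen Z ρ = seen Z ρ') : top Z ρ ⊆ top Z ρ' := by
  intro p hp
  rw [mem_top] at hp ⊢
  exact ⟨h hp.1, hs ▸ hp.2⟩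

theorem top_nonempty {Z : Finset V} {ρ : Finset (V × Finset V)}
    (h : seen Z (lower Z ρ) ≠ seen Z ρ) : (top Z ρ).Nonempty := by
  by_contra hne
  rw [Finset.not_nonempty_iff_eq_empty] at hne
  apply h
  congr 1
  refine subset_antisymm (lower_subset Z ρ) fun p hp => ?_
  rcases mem_lower_or_mem_top (Z := Z) hp with h | h
  · exact h
  · simp [hne] at h

theorem lower_card_lt {Z : Finset V} {ρ : Finset (V × Finset V)} {p : V × Finset V}
    (h : top Z ρ = {p}) : (lower Z ρ).card < ρ.card := by
  have hp : p ∈ top Z ρ := by simp [h]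
  rw [mem_top] at hp
  exact Finset.card_lt_card ⟨lower_subset Z ρ, fun hs => (mem_lower.1 (hs hp.1)).2 hp.2⟩

/-- The vertex by which `ρ` is matched. -/
noncomputable def matchVertex (pick : Finset V → V)
    (c : Finset (V × Finset V) → Finset V → V) (Z : Finset V) (ρ : Finset (V × Finset V)) :
    V × Finset V :=
  if seen Z (lower Z ρ) = seen Z ρ then (c (lower Z ρ) (seen Z ρ), seen Z ρ)
  else if _h : top Z ρ = {fresh pick Z ρ} then matchVertex pick c Z (lower Z ρ)
  else fresh pick Z ρ
termination_by ρ.card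
decreasing_by exact lower_card_lt _h

/-- The rank, compared lexicographically, that shows the matching by `matchVertex` acyclic. -/
noncomputable def matchRank (pick : Finset V → V) (Z : Finset V) (ρ : Finset (V × Finset V)) :
    List ℕ :=
  (seen Z ρ).card :: (seen Z (lower Z ρ)).card ::
    if seen Z (lower Z ρ) = seen Z ρ then [(lower Z ρ).card]
    else if _h : top Z ρ = {fresh pick Z ρ} then 0 :: matchRank pick Z (lower Z ρ)
    else [1]
termination_by ρ.card
decreasing_by exact lower_card_lt _h

variable {pick : Finset V → V} {c : Finset (V × Finset V) → Finset V → V} {Z : Finset V}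
  {ρ ρ' : Finset (V × Finset V)}

theorem matchVertex_of_eq (h : seen Z (lower Z ρ) = seen Z ρ) :
    matchVertex pick c Z ρ = (c (lower Z ρ) (seen Z ρ), seen Z ρ) := by
  rw [matchVertex, if_pos h]

theorem matchVertex_of_top (h : seen Z (lower Z ρ) ≠ seen Z ρ)
    (ht : top Z ρ = {fresh pick Z ρ}) :
    matchVertex pick c Z ρ = matchVertex pick c Z (lower Z ρ) := by
  rw [matchVertex, if_neg h, dif_pos ht]

theorem matchVertex_of_top_ne (h : seen Z (lower Z ρ) ≠ seen Z ρ)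
    (ht : top Z ρ ≠ {fresh pick Z ρ}) : matchVertex pick c Z ρ = fresh pick Z ρ := by
  rw [matchVertex, if_neg h, dif_neg ht]

theorem matchRank_of_eq (h : seen Z (lower Z ρ) = seen Z ρ) :
    matchRank pick Z ρ =
      [(seen Z ρ).card, (seen Z (lower Z ρ)).card, (lower Z ρ).card] := by
  rw [matchRank, if_pos h]

theorem matchRank_of_top (h : seen Z (lower Z ρ) ≠ seen Z ρ)
    (ht : top Z ρ = {fresh pick Z ρ}) :
    matchRank pick Z ρ = (seen Z ρ).card :: (seen Z (lower Z ρ)).card :: 0 ::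
      matchRank pick Z (lower Z ρ) := by
  rw [matchRank, if_neg h, dif_pos ht]

theorem matchRank_of_top_ne (h : seen Z (lower Z ρ) ≠ seen Z ρ)
    (ht : top Z ρ ≠ {fresh pick Z ρ}) :
    matchRank pick Z ρ = [(seen Z ρ).card, (seen Z (lower Z ρ)).card, 1] := by
  rw [matchRank, if_neg h, dif_neg ht]

theorem cons_le_cons_and {a b : ℕ} {l l' : List ℕ} {p : Prop} (hab : a ≤ b)
    (h : a = b → l ≤ l' ∧ (l = l' → p)) : a :: l ≤ b :: l' ∧ (a :: l = b :: l' → p) := by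
  rcases hab.lt_or_eq with hlt | rfl
  · refine ⟨le_of_lt (List.cons_lt_cons_iff.2 (Or.inl hlt)), fun he => ?_⟩
    exact absurd (List.cons.inj he).1 hlt.ne
  · obtain ⟨h1, h2⟩ := h rfl
    refine ⟨?_, fun he => h2 (List.cons.inj he).2⟩
    rcases h1.lt_or_eq with h1 | rfl
    · exact le_of_lt (List.cons_lt_cons_iff.2 (Or.inr ⟨rfl, h1⟩))
    · exact le_rfl

/-- Equal leading entries force equal `seen` sets and equal `seen` sets of the lower parts, so both
simplices fall on the same side of the first case split and have the same `fresh` vertex. In the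
first case equal cardinalities make the lower parts equal. In the second, the top part is nonempty,
so it can only grow away from being the singleton of the fresh vertex; this is why recursion is
marked 0 and the other branch 1. -/
theorem matchRank_mono (h : ρ ⊆ ρ') : matchRank pick Z ρ ≤ matchRank pick Z ρ' ∧
    (matchRank pick Z ρ = matchRank pick Z ρ' →
      matchVertex pick c Z ρ = matchVertex pick c Z ρ') := by
  induction hn : ρ.card using Nat.strong_induction_on generalizing ρ ρ' with
  | _ n ih =>
  subst hn
  rw [matchRank.eq_def pick Z ρ, matchRank.eq_def pick Z ρ']
  refine cons_le_cons_and (Finset.card_le_card (seen_mono h)) fun hc => ?_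
  have hs : seen Z ρ = seen Z ρ' := Finset.eq_of_subset_of_card_le (seen_mono h) hc.ge
  have hl := lower_mono h hs
  refine cons_le_cons_and (Finset.card_le_card (seen_mono hl)) fun hc' => ?_
  have hs' : seen Z (lower Z ρ) = seen Z (lower Z ρ') :=
    Finset.eq_of_subset_of_card_le (seen_mono hl) hc'.ge
  have hf : fresh pick Z ρ = fresh pick Z ρ' := by rw [fresh, fresh, hs, hs']
  by_cases heq : seen Z (lower Z ρ) = seen Z ρ
  · have heq' : seen Z (lower Z ρ') = seen Z ρ' := by rw [← hs', heq, hs]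
    rw [if_pos heq, if_pos heq']
    refine cons_le_cons_and (Finset.card_le_card hl) fun hcl => ⟨le_rfl, fun _ => ?_⟩
    rw [matchVertex_of_eq heq, matchVertex_of_eq heq',
      Finset.eq_of_subset_of_card_le hl hcl.ge, hs]
  have heq' : seen Z (lower Z ρ') ≠ seen Z ρ' := by rwa [← hs', ← hs]
  rw [if_neg heq, if_neg heq']
  by_cases ht' : top Z ρ' = {fresh pick Z ρ'}
  · have ht : top Z ρ = {fresh pick Z ρ} := by
      rw [hf, ← ht']
      refine subset_antisymm (top_mono h hs) ?_
      obtain ⟨p, hp⟩ := top_nonempty heq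
      have hp' := top_mono h hs hp
      rw [ht', Finset.mem_singleton] at hp'
      rw [ht', ← hp']
      simpa using hp
    rw [dif_pos ht, dif_pos ht']
    refine cons_le_cons_and le_rfl fun _ => ?_
    rw [matchVertex_of_top heq ht, matchVertex_of_top heq' ht']
    exact ih _ (lower_card_lt ht) hl rfl
  · rw [dif_neg ht']
    by_cases ht : top Z ρ = {fresh pick Z ρ}
    · rw [dif_pos ht]
      exact cons_le_cons_and (by omega) fun h => absurd h (by omega)
    · rw [dif_neg ht, matchVertex_of_top_ne heq ht, matchVertex_of_top_ne heq' ht', hf]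
      exact ⟨le_rfl, fun _ => rfl⟩

/-- The conditions under which a property `Q` of sets of views is compatible with the matching by
`matchVertex`. -/
structure Toggles (pick : Finset V → V) (c : Finset (V × Finset V) → Finset V → V)
    (Z : Finset V) (Q : Finset (V × Finset V) → Prop) : Prop where
  insert_of_eq : ∀ ρ, Q ρ → seen Z (lower Z ρ) = seen Z ρ →
    Q (insert (c (lower Z ρ) (seen Z ρ), seen Z ρ) ρ)
  erase_of_eq : ∀ ρ, Q ρ → seen Z (lower Z ρ) = seen Z ρ →
    Q (ρ.erase (c (lower Z ρ) (seen Z ρ), seen Z ρ))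
  insert_fresh : ∀ ρ, Q ρ → seen Z (lower Z ρ) ≠ seen Z ρ → Q (insert (fresh pick Z ρ) ρ)
  erase_fresh : ∀ ρ, Q ρ → seen Z (lower Z ρ) ≠ seen Z ρ → top Z ρ ≠ {fresh pick Z ρ} →
    Q (ρ.erase (fresh pick Z ρ))
  lower_of_top : ∀ ρ, Q ρ → seen Z (lower Z ρ) ≠ seen Z ρ → top Z ρ = {fresh pick Z ρ} →
    Q (lower Z ρ)
  insert_top : ∀ ρ N, Q ρ → seen Z ρ ⊂ N → Q (insert (pick (N \ seen Z ρ), N) ρ)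

/-- Inverts the recursive step: after `ρ` has been altered without changing what it sees, putting
the single full-view pair back leads to the recursive branch again. -/
theorem insert_top_eq {N : Finset V} (hN : seen Z ρ ⊂ N) (y : V) :
    seen Z (insert (y, N) ρ) = N ∧ lower Z (insert (y, N) ρ) = ρ ∧
      top Z (insert (y, N) ρ) = {(y, N)} := by
  have h1 : seen Z (insert (y, N) ρ) = N := by
    rw [seen_insert]
    exact Finset.union_eq_right.2 hN.1
  have h2 : ∀ p ∈ ρ, p.2 ≠ N := fun p hp he => hN.2 (he ▸ snd_subset_seen hp)
  refine ⟨h1, ?_, ?_⟩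
  · ext p
    rw [mem_lower, h1, Finset.mem_insert]
    constructor
    · rintro ⟨rfl | h, h'⟩
      exacts [absurd rfl h', h]
    · exact fun h => ⟨Or.inr h, h2 p h⟩
  · ext p
    rw [mem_top, h1, Finset.mem_insert, Finset.mem_singleton]
    constructor
    · rintro ⟨rfl | h, h'⟩
      exacts [rfl, absurd h' (h2 p h)]
    · rintro rfl
      exact ⟨Or.inl rfl, rfl⟩

theorem matchRank_insert_top {N : Finset V} (hN : seen Z ρ ⊂ N) :
    matchRank pick Z (insert (pick (N \ seen Z ρ), N) ρ) =
      N.card :: (seen Z ρ).card :: 0 :: matchRank pick Z ρ := by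
  obtain ⟨h1, h2, h3⟩ := insert_top_eq hN (pick (N \ seen Z ρ))
  rw [matchRank_of_top, h1, h2]
  · rw [h1, h2]
    exact hN.ne
  · rw [h3, fresh, h1, h2]

theorem eq_insert_lower {p : V × Finset V} (h : top Z ρ = {p}) : ρ = insert p (lower Z ρ) := by
  ext q
  rw [Finset.mem_insert, ← Finset.mem_singleton, ← h, mem_top, mem_lower]
  tauto

theorem seen_insert_full (y : V) : seen Z (insert (y, seen Z ρ) ρ) = seen Z ρ := by
  rw [seen_insert, Finset.union_self]

theorem lower_insert_full (y : V) : lower Z (insert (y, seen Z ρ) ρ) = lower Z ρ := by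
  ext p
  rw [mem_lower, mem_lower, seen_insert_full, Finset.mem_insert]
  constructor
  · rintro ⟨rfl | h, h'⟩
    exacts [absurd rfl h', ⟨h, h'⟩]
  · exact fun h => ⟨Or.inr h.1, h.2⟩

theorem lower_erase_full {y : V} (h : seen Z (ρ.erase (y, seen Z ρ)) = seen Z ρ) :
    lower Z (ρ.erase (y, seen Z ρ)) = lower Z ρ := by
  ext p
  rw [mem_lower, mem_lower, h, Finset.mem_erase]
  constructor
  · exact fun h => ⟨h.1.2, h.2⟩
  · refine fun h => ⟨⟨?_, h.1⟩, h.2⟩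
    rintro rfl
    exact h.2 rfl

theorem lower_subset_erase (y : V) : lower Z ρ ⊆ ρ.erase (y, seen Z ρ) := by
  intro p hp
  rw [mem_lower] at hp
  refine Finset.mem_erase.2 ⟨?_, hp.1⟩
  rintro rfl
  exact hp.2 rfl

/-- Outside the recursive branch the rank depends only on `seen` and `lower`, and toggling a pair
with full view alters neither as long as N stays seen. -/
theorem matchRank_congr (hs : seen Z ρ' = seen Z ρ) (hl : lower Z ρ' = lower Z ρ)
    (ht : seen Z (lower Z ρ) ≠ seen Z ρ → top Z ρ ≠ {fresh pick Z ρ} ∧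
      top Z ρ' ≠ {fresh pick Z ρ}) :
    matchRank pick Z ρ' = matchRank pick Z ρ := by
  by_cases h : seen Z (lower Z ρ) = seen Z ρ
  · rw [matchRank_of_eq h, matchRank_of_eq (by rw [hl, hs, h]), hs, hl]
  · have hf : fresh pick Z ρ' = fresh pick Z ρ := by rw [fresh, fresh, hl, hs]
    rw [matchRank_of_top_ne h (ht h).1,
      matchRank_of_top_ne (by rwa [hl, hs]) (by rw [hf]; exact (ht h).2), hs, hl]

theorem Toggles.insert_matchVertex {Q : Finset (V × Finset V) → Prop}
    (hQ : Toggles pick c Z Q) (hρ : Q ρ) :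
    Q (insert (matchVertex pick c Z ρ) ρ) ∧
      seen Z (insert (matchVertex pick c Z ρ) ρ) = seen Z ρ ∧
      matchRank pick Z (insert (matchVertex pick c Z ρ) ρ) = matchRank pick Z ρ := by
  induction hn : ρ.card using Nat.strong_induction_on generalizing ρ with
  | _ n ih =>
  subst hn
  by_cases h : seen Z (lower Z ρ) = seen Z ρ
  · rw [matchVertex_of_eq h]
    exact ⟨hQ.insert_of_eq ρ hρ h, seen_insert_full _,
      matchRank_congr (seen_insert_full _) (lower_insert_full _) fun h' => absurd h h'⟩
  by_cases ht : top Z ρ = {fresh pick Z ρ}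
  · have hss : seen Z (lower Z ρ) ⊂ seen Z ρ := (seen_lower_subset Z ρ).ssubset_of_ne h
    obtain ⟨h1, h2, h3⟩ := ih _ (lower_card_lt ht) (hQ.lower_of_top ρ hρ h ht) rfl
    rw [matchVertex_of_top h ht]
    set q := matchVertex pick c Z (lower Z ρ)
    have hρeq := eq_insert_lower ht
    rw [fresh] at hρeq
    set N := seen Z ρ
    set β := lower Z ρ
    have hss' : seen Z (insert q β) ⊂ N := by rwa [h2]
    have e : insert q ρ = insert (pick (N \ seen Z (insert q β)), N) (insert q β) := by
      rw [h2, Finset.insert_comm, ← hρeq]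
    refine ⟨?_, ?_, ?_⟩
    · rw [e]
      exact hQ.insert_top _ _ h1 hss'
    · rw [e, (insert_top_eq hss' _).1]
    · rw [e, matchRank_insert_top hss', h2, h3]
      conv_rhs => rw [hρeq]
      rw [matchRank_insert_top hss]
  · rw [matchVertex_of_top_ne h ht]
    refine ⟨hQ.insert_fresh ρ hρ h, seen_insert_full _,
      matchRank_congr (seen_insert_full _) (lower_insert_full _) fun _ => ⟨ht, fun h' => ht ?_⟩⟩
    refine (Finset.Nonempty.subset_singleton_iff (top_nonempty h)).1 ?_
    rw [← h']
    exact top_mono (Finset.subset_insert _ _) (seen_insert_full _).symm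

theorem Toggles.erase_matchVertex {Q : Finset (V × Finset V) → Prop}
    (hQ : Toggles pick c Z Q) (hρ : Q ρ) :
    Q (ρ.erase (matchVertex pick c Z ρ)) ∧
      seen Z (ρ.erase (matchVertex pick c Z ρ)) = seen Z ρ ∧
      matchRank pick Z (ρ.erase (matchVertex pick c Z ρ)) = matchRank pick Z ρ := by
  induction hn : ρ.card using Nat.strong_induction_on generalizing ρ with
  | _ n ih =>
  subst hn
  by_cases h : seen Z (lower Z ρ) = seen Z ρ
  · rw [matchVertex_of_eq h]
    have hs : seen Z (ρ.erase (c (lower Z ρ) (seen Z ρ), seen Z ρ)) = seen Z ρ := by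
      refine subset_antisymm (seen_mono (Finset.erase_subset _ _)) ?_
      conv_lhs => rw [← h]
      exact seen_mono (lower_subset_erase _)
    exact ⟨hQ.erase_of_eq ρ hρ h, hs,
      matchRank_congr hs (lower_erase_full hs) fun h' => absurd h h'⟩
  by_cases ht : top Z ρ = {fresh pick Z ρ}
  · have hss : seen Z (lower Z ρ) ⊂ seen Z ρ := (seen_lower_subset Z ρ).ssubset_of_ne h
    have hβ := hQ.lower_of_top ρ hρ h ht
    obtain ⟨h1, h2, h3⟩ := ih _ (lower_card_lt ht) hβ rfl
    have hq := (hQ.insert_matchVertex hβ).2.1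
    rw [matchVertex_of_top h ht]
    set q := matchVertex pick c Z (lower Z ρ)
    have hρeq := eq_insert_lower ht
    rw [fresh] at hρeq
    set N := seen Z ρ
    set β := lower Z ρ
    have hss' : seen Z (β.erase q) ⊂ N := by rwa [h2]
    -- The vertex toggled inside the lower part has its view within what the lower part sees, a
    -- proper subset of N.
    have hne : (pick (N \ seen Z β), N) ≠ q := by
      intro he
      have : q.2 ⊆ seen Z β := by
        rw [← hq]
        exact snd_subset_seen (Finset.mem_insert_self _ _)
      rw [← he] at this
      exact hss.2 this
    have e : ρ.erase q = insert (pick (N \ seen Z (β.erase q)), N) (β.erase q) := by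
      rw [h2, ← Finset.erase_insert_of_ne hne, ← hρeq]
    refine ⟨?_, ?_, ?_⟩
    · rw [e]
      exact hQ.insert_top _ _ h1 hss'
    · rw [e, (insert_top_eq hss' _).1]
    · rw [e, matchRank_insert_top hss', h2, h3]
      conv_rhs => rw [hρeq]
      rw [matchRank_insert_top hss]
  · rw [matchVertex_of_top_ne h ht]
    -- A second pair with view N keeps N seen after the fresh one is erased.
    obtain ⟨p, hp, hpne⟩ : ∃ p ∈ top Z ρ, p ≠ fresh pick Z ρ := by
      by_contra! hall
      exact ht ((Finset.Nonempty.subset_singleton_iff (top_nonempty h)).1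
        fun p hp => Finset.mem_singleton.2 (hall p hp))
    have hp' : p ∈ ρ.erase (fresh pick Z ρ) := Finset.mem_erase.2 ⟨hpne, (mem_top.1 hp).1⟩
    have hs : seen Z (ρ.erase (fresh pick Z ρ)) = seen Z ρ := by
      refine subset_antisymm (seen_mono (Finset.erase_subset _ _)) ?_
      rw [← (mem_top.1 hp).2]
      exact snd_subset_seen hp'
    refine ⟨hQ.erase_fresh ρ hρ h ht, hs,
      matchRank_congr hs (lower_erase_full hs) fun _ => ⟨ht, fun h' => hpne ?_⟩⟩
    rw [← Finset.mem_singleton, ← h', mem_top, hs]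
    exact ⟨hp', (mem_top.1 hp).2⟩

/-- If the simplices of `K` outside `L` are described by a property compatible with the matching
and by a condition on the set of seen processes, then `K` collapses to `L`. -/
theorem Toggles.collapsesTo [Finite V] {Q : Finset (V × Finset V) → Prop}
    (hQ : Toggles pick c Z Q) {K L : Cpx (V × Finset V)} (hLK : L ≤ K) (S : Set (Finset V))
    (hS : ∀ ρ, (ρ ∈ K ∧ ρ ∉ L) ↔ Q ρ ∧ seen Z ρ ∈ S) : CollapsesTo K L := by
  refine collapsesTo_of_matching (matchRank pick Z) (matchVertex pick c Z) K hLK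
    (fun ρ ρ' _ _ h => matchRank_mono h) ?_ ?_
  · intro ρ hK hL
    obtain ⟨hρ, hs⟩ := (hS ρ).1 ⟨hK, hL⟩
    obtain ⟨h1, h2, h3⟩ := hQ.insert_matchVertex hρ
    exact ⟨((hS _).2 ⟨h1, h2.symm ▸ hs⟩).1, h3⟩
  · intro ρ hK hL
    obtain ⟨hρ, hs⟩ := (hS ρ).1 ⟨hK, hL⟩
    obtain ⟨h1, h2, h3⟩ := hQ.erase_matchVertex hρ
    exact ⟨((hS _).2 ⟨h1, h2.symm ▸ hs⟩).2, h3⟩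

end ViewMatching

/-! ### The simplices of the read/write complex and of the chromatic subdivision -/

section Views

variable {V : Type}

/-- A set of (process, view) pairs is acyclic if each process occurs at most once and there is no
cycle of processes each of which fails to see the next one. -/
def Acyclic (ρ : Finset (V × Finset V)) : Prop :=
  (∀ p ∈ ρ, ∀ q ∈ ρ, p.1 = q.1 → p = q) ∧
    ∃ f : V × Finset V → ℕ, ∀ p ∈ ρ, ∀ q ∈ ρ, q.1 ∉ p.2 → f p < f q

/-- The immediacy condition. -/
def Immediate (ρ : Finset (V × Finset V)) : Prop :=
  ∀ p ∈ ρ, ∀ q ∈ ρ, p.1 ∈ q.2 → p.2 ⊆ q.2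

/-- The views of an immediate snapshot: self-inclusion, containment and immediacy. -/
def IsSnapshot (ρ : Finset (V × Finset V)) : Prop :=
  (∀ p ∈ ρ, p.1 ∈ p.2) ∧
    ∀ p ∈ ρ, ∀ q ∈ ρ, (p.2 ⊆ q.2 ∨ q.2 ⊆ p.2) ∧ (p.1 ∈ q.2 → p.2 ⊆ q.2)

theorem Execution.mem_view {S : Finset V} (α : Execution {v // v ∈ S}) (i j : {v // v ∈ S}) :
    (j : V) ∈ α.view i ↔ α.prec (Op.write j) (Op.read i j) := by
  simp [Execution.view]

theorem Execution.view_subset {S : Finset V} (α : Execution {v // v ∈ S}) (i : {v // v ∈ S}) :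
    α.view i ⊆ S := by
  intro x hx
  simp only [Execution.view, Finset.mem_map] at hx
  obtain ⟨j, -, rfl⟩ := hx
  exact j.2

/-- If i misses j, then the order is: write of i, read of j by i, write of j. -/
theorem Execution.write_prec_write {S : Finset V} (α : Execution {v // v ∈ S})
    {i j : {v // v ∈ S}} (h : (j : V) ∉ α.view i) : α.prec (Op.write i) (Op.write j) := by
  have := α.isStrictTotalOrder
  rw [α.mem_view] at h
  refine _root_.trans (α.write_prec_read i j) ?_
  by_contra h'
  exact nomatch Std.Trichotomous.trichotomous (r := α.prec) _ _ h h'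

/-- Views are realized by an execution as soon as there is a rank that increases from each process
to those it does not see. -/
theorem exists_execution {S : Finset V} (T : {v // v ∈ S} → Finset V) (hT : ∀ i, T i ⊆ S)
    (r : {v // v ∈ S} → ℕ) (hr : ∀ i j : {v // v ∈ S}, (j : V) ∉ T i → r i < r j) :
    ∃ α : Execution {v // v ∈ S}, ∀ i, α.view i = T i := by
  let M := 2 * Finset.univ.sup r + 1
  have hM : ∀ i, 2 * r i < M := by
    intro i
    have : r i ≤ Finset.univ.sup r := Finset.le_sup (Finset.mem_univ i)
    omega
  -- Writes occur at even times. A read that must miss comes just after the reader's own write,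
  -- hence before the later write it misses; a read that must succeed comes after all writes. A
  -- well-order breaks ties.
  let key : Op {v // v ∈ S} → ℕ
    | Op.write i => 2 * r i
    | Op.read i j => if (j : V) ∈ T i then M else 2 * r i + 1
  let α : Execution {v // v ∈ S} :=
    { prec := fun a b => Prod.Lex (· < ·) WellOrderingRel (key a, a) (key b, b)
      isStrictTotalOrder := (RelEmbedding.preimage ⟨fun a => (key a, a),
        fun _ _ h => (Prod.mk.inj h).2⟩ (Prod.Lex (· < ·) WellOrderingRel)).isStrictTotalOrder
      write_prec_read := by
        intro i j
        refine Prod.Lex.left _ _ ?_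
        simp only [key]
        split_ifs
        · exact hM i
        · omega }
  refine ⟨α, fun i => ?_⟩
  ext x
  constructor
  · intro hx
    have hxS := α.view_subset i hx
    lift x to {v // v ∈ S} using hxS
    rw [α.mem_view] at hx
    by_contra hxT
    have h1 := hr i x hxT
    have h2 : key (Op.write x) ≤ key (Op.read i x) := by
      rcases Prod.lex_iff.1 hx with h | h
      · exact h.le
      · exact h.1.le
    simp only [key, if_neg hxT] at h2
    omega
  · intro hx
    have hxS := hT i hx
    lift x to {v // v ∈ S} using hxS
    rw [α.mem_view]
    refine Prod.Lex.left _ _ ?_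
    simp only [key, if_pos hx]
    exact hM x

theorem Acyclic.mono {ρ ρ' : Finset (V × Finset V)} (h : Acyclic ρ') (hs : ρ ⊆ ρ') :
    Acyclic ρ := by
  obtain ⟨h1, f, hf⟩ := h
  exact ⟨fun p hp q hq => h1 p (hs hp) q (hs hq), f, fun p hp q hq => hf p (hs hp) q (hs hq)⟩

theorem Acyclic.fst_mem {ρ : Finset (V × Finset V)} (h : Acyclic ρ) {p : V × Finset V}
    (hp : p ∈ ρ) : p.1 ∈ p.2 := by
  obtain ⟨-, f, hf⟩ := h
  by_contra hc
  exact lt_irrefl _ (hf p hp p hp hc)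

theorem mem_wrSimplex {S : Finset V} {ρ : Finset (V × Finset V)} :
    ρ ∈ wrSimplex S ↔ Acyclic ρ ∧ seen ∅ ρ ⊆ S := by
  constructor
  · rintro ⟨α, hα⟩
    have hα' : ∀ p ∈ ρ, ∃ i : {v // v ∈ S}, p = ((i : V), α.view i) := by
      intro p hp
      obtain ⟨i, hi⟩ := hα (Finset.mem_coe.2 hp)
      exact ⟨i, hi.symm⟩
    refine ⟨⟨?_, ?_⟩, ?_⟩
    · intro p hp q hq hpq
      obtain ⟨i, rfl⟩ := hα' p hp
      obtain ⟨j, rfl⟩ := hα' q hq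
      rw [Subtype.ext hpq]
    · have := α.isStrictTotalOrder
      -- The rank counts the writes preceding that of the process; the value 0 outside `S` is never
      -- used.
      refine ⟨fun p => if h : p.1 ∈ S then
        (Finset.univ.filter fun j => α.prec (Op.write j) (Op.write ⟨p.1, h⟩)).card else 0, ?_⟩
      intro p hp q hq hpq
      obtain ⟨i, rfl⟩ := hα' p hp
      obtain ⟨j, rfl⟩ := hα' q hq
      have hij := α.write_prec_write hpq
      simp only [i.2, j.2, dif_pos, Subtype.coe_eta]
      refine Finset.card_lt_card ⟨fun l hl => ?_, fun h => ?_⟩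
      · simp only [Finset.mem_filter, Finset.mem_univ, true_and] at hl ⊢
        exact _root_.trans hl hij
      · have hi := h (Finset.mem_filter.2 ⟨Finset.mem_univ i, hij⟩)
        exact irrefl _ (Finset.mem_filter.1 hi).2
    · intro x hx
      rcases mem_seen.1 hx with hx | ⟨p, hp, hx⟩
      · simp at hx
      · obtain ⟨i, rfl⟩ := hα' p hp
        exact α.view_subset i hx
  · rintro ⟨hac, hS⟩
    obtain ⟨hinj, f, hf⟩ := id hac
    -- Processes absent from `ρ` write last and see all of `S`.
    have key : ∀ i : {v // v ∈ S}, ∃ t : Finset V × ℕ, t.1 ⊆ S ∧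
        ((∃ p ∈ ρ, p.1 = i ∧ p.2 = t.1 ∧ f p = t.2) ∨
          ((∀ p ∈ ρ, p.1 ≠ i) ∧ t = (S, ρ.sup f + 1))) := by
      intro i
      by_cases h : ∃ p ∈ ρ, p.1 = i
      · obtain ⟨p, hp, hpi⟩ := h
        exact ⟨(p.2, f p), (snd_subset_seen hp).trans hS, Or.inl ⟨p, hp, hpi, rfl, rfl⟩⟩
      · push Not at h
        exact ⟨(S, ρ.sup f + 1), subset_rfl, Or.inr ⟨h, rfl⟩⟩
    choose t htS ht using key
    obtain ⟨α, hα⟩ := exists_execution (fun i => (t i).1) htS (fun i => (t i).2) (by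
      intro i j hij
      rcases ht i with ⟨p, hp, hpi, hpt, hpf⟩ | ⟨-, hi⟩
      · rcases ht j with ⟨q, hq, hqj, hqt, hqf⟩ | ⟨-, hj⟩
        · rw [← hpf, ← hqf]
          rw [← hpt, ← hqj] at hij
          exact hf p hp q hq hij
        · simp only [hj, ← hpf]
          exact Nat.lt_succ_of_le (Finset.le_sup hp)
      · simp only [hi] at hij
        exact absurd j.2 hij)
    refine ⟨α, fun p hp => ?_⟩
    have hp' : p ∈ ρ := hp
    have hpS : p.1 ∈ S := hS (snd_subset_seen hp' (hac.fst_mem hp'))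
    refine ⟨⟨p.1, hpS⟩, ?_⟩
    rcases ht ⟨p.1, hpS⟩ with ⟨q, hq, hqp, hqt, -⟩ | ⟨h, -⟩
    · have hqp' := hinj q hq p hp' hqp
      subst hqp'
      exact Prod.ext rfl ((hα _).trans hqt.symm)
    · exact absurd rfl (h p hp')

theorem mem_wr {K : Cpx V} {ρ : Finset (V × Finset V)} :
    ρ ∈ wr K ↔ Acyclic ρ ∧ seen ∅ ρ ∈ K := by
  simp only [wr, LowerSet.mem_iSup_iff, mem_wrSimplex]
  constructor
  · rintro ⟨σ, hσ, h1, h2⟩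
    exact ⟨h1, K.lower h2 hσ⟩
  · rintro ⟨h1, h2⟩
    exact ⟨_, h2, h1, subset_rfl⟩

theorem mem_chiSimplex {S : Finset V} {ρ : Finset (V × Finset V)} :
    ρ ∈ chiSimplex S ↔ IsSnapshot ρ ∧ seen ∅ ρ ⊆ S := by
  constructor
  · rintro ⟨h1, h2⟩
    refine ⟨⟨fun p hp => (h1 p hp).1, h2⟩, fun x hx => ?_⟩
    rcases mem_seen.1 hx with hx | ⟨p, hp, hx⟩
    · simp at hx
    · exact (h1 p hp).2 hx
  · rintro ⟨⟨h1, h2⟩, h3⟩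
    exact ⟨fun p hp => ⟨h1 p hp, (snd_subset_seen hp).trans h3⟩, h2⟩

theorem mem_chi {K : Cpx V} {ρ : Finset (V × Finset V)} :
    ρ ∈ chi K ↔ IsSnapshot ρ ∧ seen ∅ ρ ∈ K := by
  simp only [chi, LowerSet.mem_iSup_iff, mem_chiSimplex]
  constructor
  · rintro ⟨σ, hσ, h1, h2⟩
    exact ⟨h1, K.lower h2 hσ⟩
  · rintro ⟨h1, h2⟩
    exact ⟨_, h2, h1, subset_rfl⟩

theorem IsSnapshot.mono {ρ ρ' : Finset (V × Finset V)} (h : IsSnapshot ρ') (hs : ρ ⊆ ρ') :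
    IsSnapshot ρ :=
  ⟨fun p hp => h.1 p (hs hp), fun p hp q hq => h.2 p (hs hp) q (hs hq)⟩

theorem IsSnapshot.acyclic {ρ : Finset (V × Finset V)} (h : IsSnapshot ρ) : Acyclic ρ := by
  obtain ⟨h1, h2⟩ := h
  refine ⟨fun p hp q hq hpq => Prod.ext hpq ?_, fun p => p.2.card, fun p hp q hq hpq => ?_⟩
  · exact subset_antisymm ((h2 p hp q hq).2 (hpq ▸ h1 q hq)) ((h2 q hq p hp).2 (hpq ▸ h1 p hp))
  · have hne : ¬ q.2 ⊆ p.2 := fun h => hpq (h (h1 q hq))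
    exact Finset.card_lt_card ⟨(h2 p hp q hq).1.resolve_right hne, hne⟩

/-- Two processes cannot both miss each other, as the rank would increase both ways; so one sees the
other, and immediacy makes their views comparable. -/
theorem Acyclic.isSnapshot_iff {ρ : Finset (V × Finset V)} (h : Acyclic ρ) :
    IsSnapshot ρ ↔ Immediate ρ := by
  refine ⟨fun hs p hp q hq => (hs.2 p hp q hq).2, fun hi => ⟨fun p hp => h.fst_mem hp,
    fun p hp q hq => ⟨?_, hi p hp q hq⟩⟩⟩
  obtain ⟨-, f, hf⟩ := h
  by_cases hpq : p.1 ∈ q.2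
  · exact Or.inl (hi p hp q hq hpq)
  by_cases hqp : q.1 ∈ p.2
  · exact Or.inr (hi q hq p hp hqp)
  · exact absurd (hf p hp q hq hqp) (hf q hq p hp hpq).asymm

/-- A nonempty immediate snapshot has a largest view. -/
theorem IsSnapshot.exists_forall_subset {ρ : Finset (V × Finset V)} (h : IsSnapshot ρ)
    (hne : ρ.Nonempty) : ∃ p ∈ ρ, ∀ q ∈ ρ, q.2 ⊆ p.2 := by
  obtain ⟨p, hp, hmax⟩ := Finset.exists_max_image ρ (fun p => p.2.card) hne
  refine ⟨p, hp, fun q hq => ?_⟩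
  rcases (h.2 q hq p hp).1 with h | h
  · exact h
  · exact (Finset.eq_of_subset_of_card_le h (hmax q hq)).ge

/-- Adding processes that see everything preserves acyclicity. -/
theorem Acyclic.of_lower {Z : Finset V} {ρ ρ' : Finset (V × Finset V)} {N : Finset V}
    (h : Acyclic ρ) (hsub : ∀ p ∈ ρ', p.2 ≠ N → p ∈ ρ) (hN : seen Z ρ' ⊆ N)
    (hmem : ∀ p ∈ ρ', p.1 ∈ p.2) (hinj : ∀ p ∈ ρ', ∀ q ∈ ρ, p.2 = N → q.2 ≠ N → p.1 ≠ q.1) :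
    Acyclic ρ' := by
  obtain ⟨h1, f, hf⟩ := h
  refine ⟨fun p hp q hq hpq => ?_, fun p => if p.2 = N then ρ.sup f + 1 else f p, ?_⟩
  · by_cases hpN : p.2 = N <;> by_cases hqN : q.2 = N
    · exact Prod.ext hpq (hpN.trans hqN.symm)
    · exact absurd hpq (hinj p hp q (hsub q hq hqN) hpN hqN)
    · exact absurd hpq.symm (hinj q hq p (hsub p hp hpN) hqN hpN)
    · exact h1 p (hsub p hp hpN) q (hsub q hq hqN) hpq
  · intro p hp q hq hpq
    by_cases hpN : p.2 = N
    · exact absurd (hN (snd_subset_seen hq (hmem q hq))) (hpN ▸ hpq)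
    · have hpρ := hsub p hp hpN
      simp only [if_neg hpN]
      split_ifs with hqN
      · exact Nat.lt_succ_of_le (Finset.le_sup hpρ)
      · exact hf p hpρ q (hsub q hq hqN) hpq

end Views

/-! ### The collapses of one round -/

section OneRound

variable {V : Type}

/-- A choice function for nonempty finite sets. -/
noncomputable def pickElement [Nonempty V] (s : Finset V) : V :=
  if h : s.Nonempty then h.choose else Classical.arbitrary V

theorem pickElement_mem [Nonempty V] {s : Finset V} (h : s.Nonempty) : pickElement s ∈ s := by
  rw [pickElement, dif_pos h]
  exact h.choose_spec

theorem pickElement_sdiff [Nonempty V] {s t : Finset V} (h : s ⊂ t) :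
    pickElement (t \ s) ∈ t ∧ pickElement (t \ s) ∉ s :=
  Finset.mem_sdiff.1 (pickElement_mem (Finset.sdiff_nonempty.2 h.2))

theorem not_immediate_mono {ρ ρ' : Finset (V × Finset V)} (h : ¬ Immediate ρ) (hs : ρ ⊆ ρ') :
    ¬ Immediate ρ' :=
  fun h' => h fun p hp q hq => h' p (hs hp) q (hs hq)

/-- Removing an element with full view that is not seen in the lower part preserves the failure
of immediacy. -/
theorem not_immediate_erase {ρ : Finset (V × Finset V)} (h : ¬ Immediate ρ) {y : V}
    (hy : y ∉ seen ∅ (lower ∅ ρ)) : ¬ Immediate (ρ.erase (y, seen ∅ ρ)) := by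
  unfold Immediate at h
  push Not at h
  obtain ⟨p, hp, q, hq, hpq, hsub⟩ := h
  have hqN : q.2 ≠ seen ∅ ρ := fun he => hsub (he ▸ snd_subset_seen hp)
  intro hi
  refine hsub (hi p (Finset.mem_erase.2 ⟨?_, hp⟩) q (Finset.mem_erase.2 ⟨?_, hq⟩) hpq)
  · rintro rfl
    exact hy (snd_subset_seen (mem_lower.2 ⟨hq, hqN⟩) hpq)
  · rintro rfl
    exact hqN rfl

/-- An immediate lower part would have a largest view, which would then be all of N; but no view in
the lower part is N. -/
theorem not_immediate_lower {ρ : Finset (V × Finset V)} (hac : Acyclic ρ) (h : ¬ Immediate ρ)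
    (hs : seen ∅ (lower ∅ ρ) = seen ∅ ρ) : ¬ Immediate (lower ∅ ρ) := by
  intro hi
  have hsnap := ((hac.mono (lower_subset ∅ ρ)).isSnapshot_iff).2 hi
  rcases (lower ∅ ρ).eq_empty_or_nonempty with he | hne
  · refine h fun p hp => absurd (snd_subset_seen (Z := ∅) hp (hac.fst_mem hp)) ?_
    rw [← hs, he]
    simp [seen]
  · obtain ⟨p, hp, hmax⟩ := hsnap.exists_forall_subset hne
    refine (mem_lower.1 hp).2 (subset_antisymm (snd_subset_seen (mem_lower.1 hp).1) ?_)
    rw [← hs]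
    intro x hx
    rcases mem_seen.1 hx with hx | ⟨q, hq, hx⟩
    · simp at hx
    · exact hmax q hq hx

/-- A pair of maximal rank sees every process of `ρ`, so these processes lie in one view, a proper
subset of `N`. This leaves a process of `N` free to receive the full view. -/
theorem Acyclic.image_fst_ssubset {ρ : Finset (V × Finset V)} {N : Finset V} (h : Acyclic ρ)
    (hne : ρ.Nonempty) (hN : ∀ p ∈ ρ, p.2 ⊂ N) : ρ.image Prod.fst ⊂ N := by
  have hmem : ∀ p ∈ ρ, p.1 ∈ p.2 := fun p hp => h.fst_mem hp
  obtain ⟨-, f, hf⟩ := h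
  obtain ⟨p, hp, hmax⟩ := Finset.exists_max_image ρ f hne
  have hsub : ρ.image Prod.fst ⊆ p.2 := by
    intro x hx
    obtain ⟨q, hq, rfl⟩ := Finset.mem_image.1 hx
    by_contra hc
    exact absurd (hf p hp q hq hc) (hmax q hq).not_gt
  exact hsub.trans_ssubset (hN p hp)

theorem Acyclic.insert_full {ρ : Finset (V × Finset V)} (h : Acyclic ρ) {y : V} {N : Finset V}
    (hN : seen ∅ ρ ⊆ N) (hyN : y ∈ N) (hy : ∀ q ∈ ρ, q.2 ≠ N → q.1 ≠ y) :
    Acyclic (insert (y, N) ρ) := by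
  refine h.of_lower (Z := ∅) (N := N) ?_ ?_ ?_ ?_
  · intro p hp hpN
    rcases Finset.mem_insert.1 hp with rfl | hp
    exacts [absurd rfl hpN, hp]
  · rw [seen_insert]
    exact Finset.union_subset hN subset_rfl
  · intro p hp
    rcases Finset.mem_insert.1 hp with rfl | hp
    exacts [hyN, h.fst_mem hp]
  · intro p hp q hq hpN hqN
    rcases Finset.mem_insert.1 hp with rfl | hp
    · exact (hy q hq hqN).symm
    · intro he
      exact hqN (h.1 p hp q hq he ▸ hpN)

theorem toggles_wr [Nonempty V] : Toggles (V := V) pickElement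
    (fun β N => pickElement (N \ β.image Prod.fst)) ∅ (fun ρ => Acyclic ρ ∧ ¬ Immediate ρ) where
  insert_of_eq := by
    rintro ρ ⟨hac, hi⟩ hs
    have hlow := not_immediate_lower hac hi hs
    have hne : (lower ∅ ρ).Nonempty := by
      by_contra he
      rw [Finset.not_nonempty_iff_eq_empty] at he
      exact hlow (by simp [he, Immediate])
    obtain ⟨h1, h2⟩ := pickElement_sdiff ((hac.mono (lower_subset ∅ ρ)).image_fst_ssubset hne
      (N := seen ∅ ρ) fun p hp => (snd_subset_seen (mem_lower.1 hp).1).ssubset_of_ne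
        (mem_lower.1 hp).2)
    refine ⟨hac.insert_full subset_rfl h1 fun q hq hqN he => h2 ?_,
      not_immediate_mono hi (Finset.subset_insert _ _)⟩
    exact Finset.mem_image.2 ⟨q, mem_lower.2 ⟨hq, hqN⟩, he⟩
  erase_of_eq := by
    rintro ρ ⟨hac, hi⟩ hs
    exact ⟨hac.mono (Finset.erase_subset _ _),
      not_immediate_mono (not_immediate_lower hac hi hs) (lower_subset_erase _)⟩
  insert_fresh := by
    rintro ρ ⟨hac, hi⟩ hs
    obtain ⟨h1, h2⟩ := pickElement_sdiff ((seen_lower_subset ∅ ρ).ssubset_of_ne hs)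
    refine ⟨hac.insert_full subset_rfl h1 ?_, not_immediate_mono hi (Finset.subset_insert _ _)⟩
    rintro q hq hqN he
    exact h2 (he ▸ snd_subset_seen (mem_lower.2 ⟨hq, hqN⟩) (hac.fst_mem hq))
  erase_fresh := by
    rintro ρ ⟨hac, hi⟩ hs -
    obtain ⟨-, h2⟩ := pickElement_sdiff ((seen_lower_subset ∅ ρ).ssubset_of_ne hs)
    exact ⟨hac.mono (Finset.erase_subset _ _), not_immediate_erase hi h2⟩
  lower_of_top := by
    rintro ρ ⟨hac, hi⟩ hs ht
    obtain ⟨-, h2⟩ := pickElement_sdiff ((seen_lower_subset ∅ ρ).ssubset_of_ne hs)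
    refine ⟨hac.mono (lower_subset _ _), not_immediate_mono (not_immediate_erase hi h2) ?_⟩
    intro p hp
    obtain ⟨h3, h4⟩ := Finset.mem_erase.1 hp
    rcases mem_lower_or_mem_top (Z := ∅) h4 with h | h
    · exact h
    · rw [ht, Finset.mem_singleton] at h
      exact absurd h h3
  insert_top := by
    rintro ρ N ⟨hac, hi⟩ hN
    obtain ⟨h1, h2⟩ := pickElement_sdiff hN
    refine ⟨hac.insert_full hN.1 h1 ?_, not_immediate_mono hi (Finset.subset_insert _ _)⟩
    rintro q hq hqN he
    exact h2 (he ▸ snd_subset_seen hq (hac.fst_mem hq))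

theorem wr_collapsesTo_chi [Finite V] [Nonempty V] (K : Cpx V) :
    CollapsesTo (wr K) (chi K) := by
  refine toggles_wr.collapsesTo ?_ {N | N ∈ K} fun ρ => ?_
  · intro ρ hρ
    have h := mem_chi.1 hρ
    exact mem_wr.2 ⟨h.1.acyclic, h.2⟩
  · rw [mem_wr, mem_chi]
    constructor
    · rintro ⟨⟨h1, h2⟩, h3⟩
      exact ⟨⟨h1, fun h => h3 ⟨h1.isSnapshot_iff.2 h, h2⟩⟩, h2⟩
    · rintro ⟨⟨h1, h2⟩, h3⟩
      exact ⟨⟨h1, h3⟩, fun h => h2 (h1.isSnapshot_iff.1 h.1)⟩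

theorem IsSnapshot.insert_full {ρ : Finset (V × Finset V)} (h : IsSnapshot ρ) {Z : Finset V}
    {y : V} {N : Finset V} (hN : seen Z ρ ⊆ N) (hyN : y ∈ N)
    (hy : ∀ q ∈ ρ, q.2 ≠ N → y ∉ q.2) : IsSnapshot (insert (y, N) ρ) := by
  have hsub : ∀ q ∈ ρ, q.2 ⊆ N := fun q hq => (snd_subset_seen hq).trans hN
  refine ⟨fun p hp => ?_, fun p hp q hq => ?_⟩
  · rcases Finset.mem_insert.1 hp with rfl | hp
    exacts [hyN, h.1 p hp]
  · rcases Finset.mem_insert.1 hq with rfl | hq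
    · rcases Finset.mem_insert.1 hp with rfl | hp
      · exact ⟨Or.inl subset_rfl, fun _ => subset_rfl⟩
      · exact ⟨Or.inl (hsub p hp), fun _ => hsub p hp⟩
    · rcases Finset.mem_insert.1 hp with rfl | hp
      · refine ⟨Or.inr (hsub q hq), fun hmem => ?_⟩
        by_contra hc
        exact hy q hq (fun he => hc he.ge) hmem
      · exact h.2 p hp q hq

theorem toggles_chi (v : V) : Toggles (@pickElement V ⟨v⟩) (fun _ _ => v) {v} IsSnapshot where
  insert_of_eq := by
    intro ρ hρ hs
    refine hρ.insert_full (Z := {v}) subset_rfl (mem_seen.2 (Or.inl (by simp))) ?_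
    -- If some lower view contained v, the largest lower view would contain v and every other lower
    -- view, hence equal N.
    intro q hq hqN hv
    have hlow := hρ.mono (lower_subset {v} ρ)
    have hql := mem_lower.2 ⟨hq, hqN⟩
    obtain ⟨p, hp, hmax⟩ := hlow.exists_forall_subset ⟨q, hql⟩
    refine (mem_lower.1 hp).2 (subset_antisymm (snd_subset_seen (mem_lower.1 hp).1) ?_)
    rw [← hs]
    intro x hx
    rcases mem_seen.1 hx with hx | ⟨r, hr, hx⟩
    · rw [Finset.mem_singleton.1 hx]
      exact hmax q hql hv
    · exact hmax r hr hx
  erase_of_eq := fun ρ hρ _ => hρ.mono (Finset.erase_subset _ _)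
  insert_fresh := by
    intro ρ hρ hs
    obtain ⟨h1, h2⟩ := @pickElement_sdiff V ⟨v⟩ _ _ ((seen_lower_subset {v} ρ).ssubset_of_ne hs)
    exact hρ.insert_full (Z := {v}) subset_rfl h1
      fun q hq hqN hy => h2 (snd_subset_seen (mem_lower.2 ⟨hq, hqN⟩) hy)
  erase_fresh := fun ρ hρ _ _ => hρ.mono (Finset.erase_subset _ _)
  lower_of_top := fun ρ hρ _ _ => hρ.mono (lower_subset _ _)
  insert_top := by
    intro ρ N hρ hN
    obtain ⟨h1, h2⟩ := @pickElement_sdiff V ⟨v⟩ _ _ hN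
    exact hρ.insert_full hN.1 h1 fun q hq _ hy => h2 (snd_subset_seen hq hy)

/-- In a finite complex, the simplices containing a free simplex `τ` are those between `τ` and the
maximal simplex containing it. -/
theorem IsFree.exists_facet [Finite V] {K : Cpx V} {τ : Finset V} (h : IsFree K τ) :
    ∃ σ ∈ K, τ ⊂ σ ∧ ∀ ρ ∈ K, τ ⊆ ρ → ρ ⊆ σ := by
  obtain ⟨σ, hσ, hτσ, huniq⟩ := h
  refine ⟨σ, hσ.1, hτσ, fun ρ hρ hτρ => ?_⟩
  obtain ⟨σ', hσ', hsub⟩ := ReadWrite.exists_facet hρ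
  exact huniq σ' hσ' (hτρ.trans hsub) ▸ hsub

/-- The removed simplices are the snapshots whose seen set lies in `K` and contains `τ`. Adding v to
the seen set does not affect this: v ∉ τ, and every simplex of `K` over `τ` lies in the facet σ,
which contains v. The case τ = ∅ is included, with `L` void. -/
theorem CollapseStep.chi [Finite V] {K L : Cpx V} (h : CollapseStep K L) :
    CollapsesTo (chi K) (chi L) := by
  obtain ⟨τ, hfree, hL⟩ := h
  obtain ⟨σ, hσ, hτσ, hover⟩ := hfree.exists_facet
  obtain ⟨v, hvσ, hvτ⟩ := Finset.exists_of_ssubset hτσ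
  refine (toggles_chi v).collapsesTo ?_ {N | N ∈ K ∧ τ ⊆ N} fun ρ => ?_
  · intro ρ hρ
    have h := mem_chi.1 hρ
    exact mem_chi.2 ⟨h.1, ((hL _).1 h.2).1⟩
  · have hseen : seen {v} ρ = insert v (seen ∅ ρ) := by
      ext x
      simp [mem_seen]
    have hiff : (insert v (seen ∅ ρ) ∈ K ∧ τ ⊆ insert v (seen ∅ ρ)) ↔
        seen ∅ ρ ∈ K ∧ τ ⊆ seen ∅ ρ := by
      constructor
      · rintro ⟨h1, h2⟩
        exact ⟨K.lower (Finset.subset_insert _ _) h1, (Finset.subset_insert_iff_of_notMem hvτ).1 h2⟩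
      · rintro ⟨h1, h2⟩
        exact ⟨K.lower (Finset.insert_subset hvσ (hover _ h1 h2)) hσ,
          h2.trans (Finset.subset_insert _ _)⟩
    rw [mem_chi, mem_chi, hL, Set.mem_ofPred_eq, hseen, hiff]
    tauto

theorem CollapsesTo.chi [Finite V] {K L : Cpx V} (h : CollapsesTo K L) :
    CollapsesTo (chi K) (chi L) := by
  induction h with
  | refl => exact Relation.ReflTransGen.refl
  | tail _ h ih => exact ih.trans h.chi

theorem chi_bot : chi (⊥ : Cpx V) = ⊥ := by
  simp [chi]

theorem collapsible_top [Fintype V] [Nonempty V] : Collapsible (⊤ : Cpx V) := by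
  refine Relation.ReflTransGen.single ⟨∅, ⟨Finset.univ, ⟨trivial, fun _ _ _ => Finset.subset_univ _⟩,
    Finset.univ_nonempty.empty_ssubset, fun ρ hρ _ => ?_⟩, fun ρ => ?_⟩
  · exact Finset.univ_subset_iff.1 (hρ.2 (y := Finset.univ) trivial (Finset.subset_univ _))
  · simp

end OneRound

/-! ### Iterated rounds -/

instance instNonemptyVert (n : ℕ) : ∀ k, Nonempty (Vert n k)
  | 0 => inferInstanceAs (Nonempty (Fin (n + 1)))
  | k + 1 =>
    letI := instNonemptyVert n k
    inferInstanceAs (Nonempty (Vert n k × Finset (Vert n k)))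

theorem wrIter_collapsesTo_chiIter (n k : ℕ) : CollapsesTo (wrIter n k) (chiIter n k) := by
  induction k with
  | zero => exact Relation.ReflTransGen.refl
  | succ k ih => exact (wr_collapsesTo_chi (wrIter n k)).trans ih.chi

theorem collapsible_chiIter (n k : ℕ) : Collapsible (chiIter n k) := by
  induction k with
  | zero => exact collapsible_top (V := Fin (n + 1))
  | succ k ih =>
    have h := CollapsesTo.chi ih
    rwa [chi_bot] at h

theorem collapsible_wrIter (n k : ℕ) : Collapsible (wrIter n k) :=
  (wrIter_collapsesTo_chiIter n k).trans (collapsible_chiIter n k)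

/-! ### Contractibility of collapsible complexes -/

section Realization

variable {V : Type}

/-- The smallest barycentric coordinate of `x` at the vertices of `τ`. -/
noncomputable def minCoord (τ : Finset V) (hτ : τ.Nonempty) (x : V → ℝ) : ℝ :=
  τ.inf' hτ x

/-- Move the mass `t * minCoord τ hτ x` from every vertex of `τ` to the vertex `v`. -/
noncomputable def push (τ : Finset V) (hτ : τ.Nonempty) (v : V) (t : ℝ) (x : V → ℝ) : V → ℝ :=
  fun u => x u - t * minCoord τ hτ x * (if u ∈ τ then 1 else 0) +
    t * minCoord τ hτ x * τ.card * (if u = v then 1 else 0)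

theorem continuous_minCoord (τ : Finset V) (hτ : τ.Nonempty) : Continuous (minCoord τ hτ) :=
  Continuous.finset_inf'_apply hτ fun u _ => continuous_apply u

theorem continuous_push (τ : Finset V) (hτ : τ.Nonempty) (v : V) :
    Continuous fun p : ℝ × (V → ℝ) => push τ hτ v p.1 p.2 := by
  have h := continuous_minCoord τ hτ
  unfold push
  fun_prop

variable [Fintype V]

theorem mem_realization {K : Cpx V} {x : V → ℝ} :
    x ∈ realization K ↔ x ∈ stdSimplex ℝ V ∧ Finset.univ.filter (fun v => x v ≠ 0) ∈ K := by
  refine and_congr_right fun _ => ⟨?_, fun h => ⟨_, h, by simp⟩⟩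
  rintro ⟨σ, hσ, h⟩
  convert hσ using 1
  ext v
  simp [h]

theorem realization_mono {K L : Cpx V} (h : L ≤ K) : realization L ⊆ realization K :=
  fun _ ⟨h1, σ, h2, h3⟩ => ⟨h1, σ, h h2, h3⟩

theorem push_mem_stdSimplex {τ : Finset V} (hτ : τ.Nonempty) (v : V) {t : ℝ} (ht0 : 0 ≤ t)
    (ht1 : t ≤ 1) {x : V → ℝ} (hx : x ∈ stdSimplex ℝ V) :
    push τ hτ v t x ∈ stdSimplex ℝ V := by
  have hm : 0 ≤ minCoord τ hτ x := Finset.le_inf' _ _ fun u _ => hx.1 u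
  refine ⟨fun u => ?_, ?_⟩
  · have h1 : 0 ≤ x u - t * minCoord τ hτ x * (if u ∈ τ then 1 else 0) := by
      split_ifs with hu
      · have : minCoord τ hτ x ≤ x u := Finset.inf'_le _ hu
        nlinarith
      · simpa using hx.1 u
    have h2 : 0 ≤ t * minCoord τ hτ x * τ.card * (if u = v then 1 else 0) := by
      split_ifs <;> positivity
    exact add_nonneg h1 h2
  · simp only [push, Finset.sum_add_distrib, Finset.sum_sub_distrib, ← Finset.mul_sum, hx.2]
    simp

theorem subset_support_of_minCoord_ne_zero {τ : Finset V} (hτ : τ.Nonempty) {x : V → ℝ} (hx : x ∈ stdSimplex ℝ V)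
    (h : minCoord τ hτ x ≠ 0) : τ ⊆ Finset.univ.filter fun v => x v ≠ 0 := by
  have hm : 0 ≤ minCoord τ hτ x := Finset.le_inf' _ _ fun u _ => hx.1 u
  intro u hu
  have : minCoord τ hτ x ≤ x u := Finset.inf'_le _ hu
  simp only [Finset.mem_filter, Finset.mem_univ, true_and]
  exact ((hm.lt_of_ne' h).trans_le this).ne'

/-- Mass moves only if all coordinates on `τ` are positive; then the support contains `τ`, so it
lies in `σ`, and moving mass to `v ∈ σ` stays in that simplex. -/
theorem push_mem_realization {K : Cpx V} {τ σ : Finset V} (hτ : τ.Nonempty) (hσ : σ ∈ K)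
    (hover : ∀ ρ ∈ K, τ ⊆ ρ → ρ ⊆ σ) {v : V} (hv : v ∈ σ) {t : ℝ} (ht0 : 0 ≤ t) (ht1 : t ≤ 1)
    (hτσ : τ ⊆ σ) {x : V → ℝ} (hx : x ∈ realization K) : push τ hτ v t x ∈ realization K := by
  rw [mem_realization] at hx ⊢
  refine ⟨push_mem_stdSimplex hτ v ht0 ht1 hx.1, ?_⟩
  by_cases hm : minCoord τ hτ x = 0
  · have : push τ hτ v t x = x := by
      ext u
      simp [push, hm]
    rw [this]
    exact hx.2
  · have hsub := hover _ hx.2 (subset_support_of_minCoord_ne_zero hτ hx.1 hm)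
    refine K.lower (fun u hu => ?_) hσ
    by_contra huσ
    have h1 : u ∉ τ := fun h => huσ (hτσ h)
    have h2 : u ≠ v := fun h => huσ (h ▸ hv)
    have h3 : x u = 0 := by
      by_contra h
      exact huσ (hsub (by simpa using h))
    simp [push, h1, h2, h3] at hu

/-- The vertex of `τ` where the minimum is attained loses all its mass and is not refilled, as `v`
is outside `τ`. -/
theorem push_one_not_subset {τ : Finset V} (hτ : τ.Nonempty) {v : V} (hv : v ∉ τ) (x : V → ℝ) :
    ¬ τ ⊆ Finset.univ.filter fun u => push τ hτ v 1 x u ≠ 0 := by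
  intro h
  obtain ⟨u, hu, he⟩ := Finset.exists_mem_eq_inf' hτ x
  have huv : u ≠ v := fun h => hv (h ▸ hu)
  have := h hu
  simp [push, hu, huv, minCoord, he] at this

theorem contractibleSpace_of_collapse {K L : Cpx V} {τ : Finset V} (hτ : τ.Nonempty)
    (hfree : IsFree K τ) (hL : ∀ ρ, ρ ∈ L ↔ ρ ∈ K ∧ ¬ τ ⊆ ρ)
    [ContractibleSpace (realization L)] : ContractibleSpace (realization K) := by
  obtain ⟨σ, hσ, hτσ, hover⟩ := hfree.exists_facet
  obtain ⟨v, hvσ, hvτ⟩ := Finset.exists_of_ssubset hτσ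
  have hpush : ∀ t : unitInterval, ∀ x ∈ realization K, push τ hτ v t x ∈ realization K :=
    fun t x hx => push_mem_realization hτ hσ hover hvσ t.2.1 t.2.2 hτσ.1 hx
  have hret : ∀ x ∈ realization K, push τ hτ v 1 x ∈ realization L := by
    intro x hx
    have h := mem_realization.1 (push_mem_realization hτ hσ hover hvσ zero_le_one le_rfl hτσ.1 hx)
    exact mem_realization.2 ⟨h.1, (hL _).2 ⟨h.2, push_one_not_subset hτ hvτ x⟩⟩
  have hcont := continuous_push τ hτ v
  let r : C(realization K, realization L) :=
    ⟨fun x => ⟨push τ hτ v 1 x, hret x x.2⟩, by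
      refine Continuous.subtype_mk ?_ _
      exact hcont.comp (Continuous.prodMk continuous_const continuous_subtype_val)⟩
  let ι : C(realization L, realization K) :=
    ⟨Set.inclusion (realization_mono fun ρ hρ => ((hL ρ).1 hρ).1), continuous_inclusion _⟩
  have hhom : (ContinuousMap.id (realization K)).Homotopic (ι.comp r) :=
    ⟨{ toFun := fun p => ⟨push τ hτ v p.1 p.2, hpush p.1 p.2 p.2.2⟩
       continuous_toFun := by
         refine Continuous.subtype_mk ?_ _
         exact hcont.comp (Continuous.prodMk (continuous_subtype_val.comp continuous_fst)
           (continuous_subtype_val.comp continuous_snd))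
       map_zero_left := fun x => Subtype.ext (by
         ext u
         simp [push])
       map_one_left := fun x => rfl }⟩
  obtain ⟨y, hy⟩ := ((id_nullhomotopic (realization L)).comp_left r).comp_right ι
  rw [contractible_iff_id_nullhomotopic]
  exact ⟨y, hhom.trans hy⟩

/-- Every facet contains ∅, so there is only one: `K` is a full nonempty simplex with convex
realization. -/
theorem contractibleSpace_of_isFree_empty {K : Cpx V} (h : IsFree K ∅) :
    ContractibleSpace (realization K) := by
  obtain ⟨σ, hσ, hτσ, hover⟩ := h.exists_facet
  obtain ⟨v, hv, -⟩ := Finset.exists_of_ssubset hτσ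
  have hK : ∀ ρ, ρ ∈ K ↔ ρ ⊆ σ :=
    fun ρ => ⟨fun hρ => hover ρ hρ (Finset.empty_subset _), fun hρ => K.lower hρ hσ⟩
  have heq : realization K = stdSimplex ℝ V ∩ {x | ∀ u ∉ σ, x u = 0} := by
    ext x
    rw [mem_realization, hK, Set.mem_inter_iff]
    refine and_congr_right fun _ => ⟨fun h u hu => ?_, fun h u hu => ?_⟩
    · by_contra hne
      exact hu (h (by simpa using hne))
    · by_contra hne
      simp [h u hne] at hu
  rw [heq]
  refine Convex.contractibleSpace ((convex_stdSimplex ℝ V).inter ?_)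
    ⟨Pi.single v 1, single_mem_stdSimplex ℝ v, fun u hu => ?_⟩
  · intro x hx y hy a b _ _ _ u hu
    simp [hx u hu, hy u hu]
  · exact Pi.single_eq_of_ne (ne_of_mem_of_not_mem hv hu).symm _

theorem Collapsible.contractibleSpace {K : Cpx V} (h : Collapsible K) (hne : K ≠ ⊥) :
    ContractibleSpace (realization K) := by
  induction h using Relation.ReflTransGen.head_induction_on with
  | refl => exact absurd rfl hne
  | @head K L hstep _ ih =>
    obtain ⟨τ, hfree, hL⟩ := hstep
    rcases τ.eq_empty_or_nonempty with rfl | hτ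
    · exact contractibleSpace_of_isFree_empty hfree
    · have hLne : L ≠ ⊥ := by
        intro hbot
        obtain ⟨σ, hσ, -, -⟩ := hfree.exists_facet
        have h0 : ∅ ∈ L := (hL ∅).2 ⟨K.lower (Finset.empty_subset σ) hσ,
          fun h => hτ.ne_empty (Finset.subset_empty.1 h)⟩
        rw [hbot] at h0
        exact h0
      have := ih hLne
      exact contractibleSpace_of_collapse hτ hfree hL

end Realization

theorem empty_mem_wr {V : Type} {K : Cpx V} (h : ∅ ∈ K) : ∅ ∈ wr K :=
  mem_wr.2 ⟨⟨by simp, 0, by simp⟩, by simpa [seen] using h⟩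

theorem empty_mem_wrIter (n k : ℕ) : ∅ ∈ wrIter n k := by
  induction k with
  | zero => trivial
  | succ k ih => exact empty_mem_wr ih

end ReadWrite

theorem mainTheorem3 (n k : ℕ) (hk : 1 ≤ k) :
    ReadWrite.CollapsesTo (ReadWrite.wrIter n k) (ReadWrite.chiIter n k) ∧
      ReadWrite.Collapsible (ReadWrite.chiIter n k) ∧
      ReadWrite.Collapsible (ReadWrite.wrIter n k) ∧
      ContractibleSpace (ReadWrite.realization (ReadWrite.wrIter n k)) := by
  refine ⟨ReadWrite.wrIter_collapsesTo_chiIter n k, ReadWrite.collapsible_chiIter n k,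
    ReadWrite.collapsible_wrIter n k, (ReadWrite.collapsible_wrIter n k).contractibleSpace ?_⟩
  intro h
  have h0 := ReadWrite.empty_mem_wrIter n k
  rw [h] at h0
  exact h0
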